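/- Let $n,k\ge 0$ be integers and let $\Gamma_{n,k}$ be the set of directed graphs with vertices numbered $1,\dots,n$ and edges numbered $1,\dots,k$, that is, of sequences $([a_1,b_1],\dots,[a_k,b_k])$ of ordered pairs of elements of $\{1,\dots,n\}$; loops $[a,a]$ and parallel edges are allowed. Let $\mathcal G_{n,k}$ be the complex vector space with basis $\Gamma_{n,k}$. For $1\le i\le k$ let $B_i:\mathcal G_{n,k}\to\mathcal G_{n,k}$ be the linear operator such that, for $G\in\Gamma_{n,k}$ with edge number $i$ equal to $[a,b]$, $$B_i(G)=\begin{cases} G, & a\ne b,\\ -\sum_{m\ne a} R_{a,m;i}G, & a=b,\end{cases}$$ where $R_{a,m;i}G$ is $G$ with its edge number $i$ replaced by $[a,m]$. The Laplace operator is $\Delta=B_1B_2\cdots B_k$. A graph is acyclic if it contains no directed cycles (a loop is a directed cycle of length $1$), and totally cyclic if each of its edges is part of a directed cycle. A vertex is isolated if it is not incident to any edge (loops included), and a sink if no edge starts at it. Let $\beta_0(G)$ be the number of connected components of $G$. For $I\subseteq\{1,\dots,n\}$ let $\mathrm{SSC}^I_{n,k}$ be the set of totally cyclic $G\in\Gamma_{n,k}$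 whose set of isolated vertices is exactly $I$, let $\mathrm{AC}^I_{n,k}$ be the set of acyclic $G\in\Gamma_{n,k}$ whose set of sinks is exactly $I$, and let $$\det\nolimits^I_{n,k}=\frac{(-1)^k}{k!}\sum_{G\in \mathrm{SSC}^I_{n,k}}(-1)^{\beta_0(G)}\,G\in\mathcal G_{n,k}$$ be the diagonal $I$-minor. Then, for every $I\subseteq\{1,\dots,n\}$, $$\Delta\det\nolimits^I_{n,k}=\frac{(-1)^n}{k!}\sum_{G\in \mathrm{AC}^I_{n,k}}G .$$ -/

import Mathlib

/-- Directed graphs with numbered vertices `Fin n` and numbered edges `Fin k`: sequences of `k`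
ordered pairs `(a, b)` (edge from `a` to `b`). Loops and parallel edges are allowed. -/
abbrev DGraph (n k : ℕ) : Type := Fin k → Fin n × Fin n

namespace DGraph

variable {n k : ℕ}

/-- `e 0, …, e m` are the successive edges of a directed cycle of length `m + 1` in `G`: the end of
each edge is the start of the next one (cyclically, addition in `Fin (m + 1)` being modulo `m + 1`),
and no vertex is visited twice. A loop is a directed cycle of length `1` (the case `m = 0`). -/
def IsDirectedCycle (G : DGraph n k) (m : ℕ) (e : Fin (m + 1) → Fin k) : Prop :=
  (∀ j : Fin (m + 1), (G (e j)).2 = (G (e (j + 1))).1) ∧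
    Function.Injective (fun j : Fin (m + 1) => (G (e j)).1)

/-- `G` contains no directed cycle. -/
def IsAcyclic (G : DGraph n k) : Prop :=
  ∀ (m : ℕ) (e : Fin (m + 1) → Fin k), ¬ G.IsDirectedCycle m e

/-- Every edge of `G` is part of a directed cycle. -/
def IsTotallyCyclic (G : DGraph n k) : Prop :=
  ∀ i : Fin k, ∃ (m : ℕ) (e : Fin (m + 1) → Fin k), G.IsDirectedCycle m e ∧ ∃ j, e j = i

/-- The vertex `v` is not incident to any edge (loops included). -/
def IsIsolated (G : DGraph n k) (v : Fin n) : Prop :=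
  ∀ i : Fin k, (G i).1 ≠ v ∧ (G i).2 ≠ v

/-- The vertex `v` has no edges starting at it. -/
def IsSink (G : DGraph n k) (v : Fin n) : Prop :=
  ∀ i : Fin k, (G i).1 ≠ v

/-- The simple graph on the vertices of `G` obtained by forgetting loops, orientation and
multiplicity of the edges; it has the same connected components as `G`. -/
def toSimpleGraph (G : DGraph n k) : SimpleGraph (Fin n) :=
  SimpleGraph.fromRel (fun a b => ∃ i : Fin k, G i = (a, b))

/-- The number of connected components. -/
noncomputable def betti0 (G : DGraph n k) : ℕ :=
  Nat.card G.toSimpleGraph.ConnectedComponent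

/-- The graph `G` with edge number `i` replaced by the edge `(p, q)`, carrying the same number. -/
def replaceEdge (p q : Fin n) (i : Fin k) (G : DGraph n k) : DGraph n k :=
  Function.update G i (p, q)

/-- The complex vector space spanned by the directed graphs. -/
abbrev Space (n k : ℕ) : Type := DGraph n k →₀ ℂ

/-- The basis vector of `Space n k` corresponding to `G`. -/
noncomputable def basisVec (G : DGraph n k) : Space n k := Finsupp.single G 1

/-- The linear operator `B_i`: it fixes `G` if the edge number `i` is not a loop, and sends `G` to
minus the sum of the graphs with the edge `i` replaced by `(a, m)`, `m ≠ a`, if it is the loop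
`(a, a)`. -/
noncomputable def edgeOp (i : Fin k) : Space n k →ₗ[ℂ] Space n k :=
  Finsupp.linearCombination ℂ (fun G : DGraph n k =>
    if (G i).1 ≠ (G i).2 then basisVec G
    else - ∑ m ∈ Finset.univ.erase (G i).1, basisVec (replaceEdge (G i).1 m i G))

/-- The Laplace operator: the composition `B_1 ⋯ B_k`. -/
noncomputable def laplace (n k : ℕ) : Space n k →ₗ[ℂ] Space n k :=
  (List.ofFn (fun i : Fin k => (edgeOp i : Module.End ℂ (Space n k)))).prod

open Classical in
/-- The totally cyclic graphs whose isolated vertices are exactly the elements of `I`. -/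
noncomputable def SSC (n k : ℕ) (I : Finset (Fin n)) : Finset (DGraph n k) :=
  Finset.univ.filter (fun G => G.IsTotallyCyclic ∧ ∀ v : Fin n, G.IsIsolated v ↔ v ∈ I)

open Classical in
/-- The acyclic graphs whose sinks are exactly the elements of `I`. -/
noncomputable def AC (n k : ℕ) (I : Finset (Fin n)) : Finset (DGraph n k) :=
  Finset.univ.filter (fun G => G.IsAcyclic ∧ ∀ v : Fin n, G.IsSink v ↔ v ∈ I)

/-- The diagonal `I`-minor `det^I_{n,k}`. -/
noncomputable def diagMinor (n k : ℕ) (I : Finset (Fin n)) : Space n k :=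
  ((-1 : ℂ) ^ k / (k.factorial : ℂ)) • ∑ G ∈ SSC n k I, (-1 : ℂ) ^ G.betti0 • basisVec G

end DGraph

namespace DGraph

open Relation

variable {n k : ℕ}

/-! Compare coefficients at a graph `H`. Dually, `B_i` gives coefficient 0 when edge `i` of `H` is a
loop, and otherwise subtracts the coefficient of `H` with edge `i` contracted to a loop at its
start. So for loopless `H` the coefficient of `Δx` is the signed sum over edge sets `S` of `x` at
`H.replaceByLoops S` (`laplace_apply`). That graph is totally cyclic iff the edges `T = Sᶜ` of `H`
are, and then its isolated vertices are the sinks of `H`. The theorem reduces to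
`sum_totallyCyclicOn`: the sum of (-1)^(|T| + β₀(T)) over totally cyclic `T` is (-1)^n if `H` is
acyclic, else 0.

By Möbius inversion over edge sets this follows from the evaluation of `acyclicSum F`: it is (-1)^(n
+ β₀(F)) if `F` is totally cyclic (`TotallyCyclicOn.acyclicSum_eq`) and 0 otherwise
(`acyclicSum_eq_zero`). An edge on no cycle of `F` can be toggled, which cancels everything. If `F`
is totally cyclic, its components are strongly connected and are stripped off one by one by
inclusion-exclusion over their sinks. -/

/-- The relation on vertices given by the edges of `G` with numbers in `A`. -/
def EdgeRel (G : DGraph n k) (A : Finset (Fin k)) (u v : Fin n) : Prop :=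
  ∃ i ∈ A, G i = (u, v)

/-- The directed walks of `G` with edges in `A` run from `u` to `v`. -/
abbrev Walks (G : DGraph n k) (A : Finset (Fin k)) : Fin n → Fin n → Prop :=
  ReflTransGen (G.EdgeRel A)

/-- The subgraph of `G` with edge set `A` is acyclic. -/
def AcyclicOn (G : DGraph n k) (A : Finset (Fin k)) : Prop :=
  ∀ i ∈ A, ¬ G.Walks A (G i).2 (G i).1

/-- The subgraph of `G` with edge set `A` is totally cyclic. -/
def TotallyCyclicOn (G : DGraph n k) (A : Finset (Fin k)) : Prop :=
  ∀ i ∈ A, G.Walks A (G i).2 (G i).1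

theorem edgeRel_of_mem (G : DGraph n k) {A : Finset (Fin k)} {i : Fin k} (hi : i ∈ A) :
    G.EdgeRel A (G i).1 (G i).2 :=
  ⟨i, hi, rfl⟩

theorem EdgeRel.mono {G : DGraph n k} {A B : Finset (Fin k)} (h : A ⊆ B) {u v : Fin n}
    (huv : G.EdgeRel A u v) : G.EdgeRel B u v := by
  obtain ⟨i, hi, e⟩ := huv
  exact ⟨i, h hi, e⟩

theorem Walks.mono {G : DGraph n k} {A B : Finset (Fin k)} (h : A ⊆ B) {u v : Fin n}
    (huv : G.Walks A u v) : G.Walks B u v :=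
  ReflTransGen.mono (fun _ _ => EdgeRel.mono h) _ _ huv

/-! ### Directed cycles and walks -/

theorem exists_nodup_isChain {α : Type*} {r : α → α → Prop} {a b : α}
    (h : ReflTransGen r a b) :
    ∃ l : List α, (a :: l).Nodup ∧ (a :: l).IsChain r ∧
      (a :: l).getLast (List.cons_ne_nil a l) = b := by
  classical
  induction h using ReflTransGen.head_induction_on with
  | refl => exact ⟨[], by simp⟩
  | @head a c hac _ ih =>
    obtain ⟨l, hn, hc, hl⟩ := ih
    -- If the path already visits `a`, keep only its part from `a` on.
    by_cases ha : a ∈ c :: l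
    · obtain ⟨s, t, hst⟩ := List.append_of_mem ha
      have hsuf : (a :: t) <:+ (c :: l) := ⟨s, hst.symm⟩
      refine ⟨t, hn.sublist hsuf.sublist, hc.suffix hsuf, ?_⟩
      rw [← hl, hsuf.getLast]
    · refine ⟨c :: l, List.nodup_cons.2 ⟨ha, hn⟩, List.isChain_cons_cons.2 ⟨hac, hc⟩, ?_⟩
      rw [List.getLast_cons (List.cons_ne_nil c l), hl]

theorem IsDirectedCycle.walks {G : DGraph n k} {m : ℕ} {e : Fin (m + 1) → Fin k}
    (h : G.IsDirectedCycle m e) (j : Fin (m + 1)) :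
    G.Walks Finset.univ (G (e j)).2 (G (e j)).1 := by
  have key : ∀ t : ℕ, ∀ s : Fin (m + 1),
      G.Walks Finset.univ (G (e s)).1 (G (e (s + Fin.ofNat (m + 1) t))).1 := by
    intro t s
    induction t with
    | zero =>
      have : s + Fin.ofNat (m + 1) 0 = s := add_zero s
      rw [this]
    | succ t ih =>
      have : s + Fin.ofNat (m + 1) (t + 1) = s + Fin.ofNat (m + 1) t + 1 := by
        rw [add_assoc]
        congr 1
        ext
        simp [Fin.val_add]
      refine ih.tail ⟨e (s + Fin.ofNat (m + 1) t), Finset.mem_univ _, ?_⟩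
      rw [this, ← h.1]
  have := key m (j + 1)
  rw [h.1 j]
  -- Going `m` steps on from `j + 1` closes the cycle.
  have hm : j + 1 + Fin.ofNat (m + 1) m = j := by
    rw [add_assoc]
    convert add_zero j
    ext
    simp [add_comm]
  rwa [hm] at this

/-- A repetition-free path from the head of `i` to its tail is closed up by `i`, placed at the last
index, where `j + 1` wraps to 0. -/
theorem exists_isDirectedCycle {G : DGraph n k} {i : Fin k}
    (h : G.Walks Finset.univ (G i).2 (G i).1) :
    ∃ (m : ℕ) (e : Fin (m + 1) → Fin k), G.IsDirectedCycle m e ∧ ∃ j, e j = i := by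
  obtain ⟨l, hn, hc, hl⟩ := exists_nodup_isChain h
  set p : List (Fin n) := (G i).2 :: l with hp
  have hlen : p.length = l.length + 1 := by simp [hp]
  have hstep : ∀ j : Fin (l.length + 1), ∃ x : Fin k,
      (G x).1 = p[j.1]'(by omega) ∧
        (G x).2 = p[(j + 1 : Fin (l.length + 1)).1]'(lt_of_lt_of_eq (j + 1).2 hlen.symm) ∧
        (j = Fin.last _ → x = i) := by
    intro j
    by_cases hj : j = Fin.last _
    · subst hj
      refine ⟨i, ?_, ?_, fun _ => rfl⟩
      · rw [← hl, List.getLast_eq_getElem]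
        simp [hp]
      · simp [hp]
    · have hj' : (j + 1 : Fin (l.length + 1)).1 = j.1 + 1 :=
        Fin.val_add_one_of_lt (Fin.lt_last_iff_ne_last.2 hj)
      have hlt : j.1 + 1 < p.length := by
        have := (j + 1 : Fin (l.length + 1)).2
        omega
      obtain ⟨x, -, hx⟩ := hc.getElem j.1 hlt
      refine ⟨x, by rw [hx], ?_, fun h' => absurd h' hj⟩
      rw [hx]
      simp only [hj']
  choose e he1 he2 he3 using hstep
  refine ⟨l.length, e, ⟨fun j => by rw [he2, he1], fun a b hab => ?_⟩, Fin.last _, he3 _ rfl⟩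
  simp only [he1] at hab
  exact Fin.ext ((hn.getElem_inj_iff).1 hab)

theorem isTotallyCyclic_iff (G : DGraph n k) :
    G.IsTotallyCyclic ↔ G.TotallyCyclicOn Finset.univ := by
  constructor
  · intro h i _
    obtain ⟨m, e, he, j, rfl⟩ := h i
    exact he.walks j
  · exact fun h i => exists_isDirectedCycle (h i (Finset.mem_univ i))

theorem isAcyclic_iff (G : DGraph n k) : G.IsAcyclic ↔ G.AcyclicOn Finset.univ := by
  constructor
  · intro h i _ hw
    obtain ⟨m, e, he, -⟩ := exists_isDirectedCycle hw
    exact h m e he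
  · exact fun h m e he => h (e 0) (Finset.mem_univ _) (he.walks 0)

/-! ### Alternating sums over acyclic edge sets -/

/-- Toggling `i` is a sign-reversing involution preserving `Q`. -/
theorem sum_powerset_filter_eq_zero {α : Type*} [DecidableEq α] {F : Finset α}
    {Q : Finset α → Prop} [DecidablePred Q] {i : α} (hi : i ∈ F)
    (hQ : ∀ A ⊆ F, i ∉ A → (Q (insert i A) ↔ Q A)) :
    ∑ A ∈ F.powerset with Q A, (-1 : ℤ) ^ A.card = 0 := by
  rw [Finset.sum_filter, ← Finset.insert_erase hi,
    Finset.sum_powerset_insert (Finset.notMem_erase i F), ← Finset.sum_add_distrib]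
  refine Finset.sum_eq_zero fun A hA => ?_
  rw [Finset.mem_powerset] at hA
  have hiA : i ∉ A := fun h => Finset.notMem_erase i F (hA h)
  rw [if_congr (hQ A (hA.trans (Finset.erase_subset i F)) hiA) rfl rfl,
    Finset.card_insert_of_notMem hiA]
  split_ifs <;> ring

theorem Walks.of_insert {G : DGraph n k} {A : Finset (Fin k)} {i : Fin k} {u v : Fin n}
    (h : G.Walks (insert i A) u v) :
    G.Walks A u v ∨ (G.Walks (insert i A) u (G i).1 ∧ G.Walks (insert i A) (G i).2 v) := by
  induction h with
  | refl => exact Or.inl ReflTransGen.refl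
  | @tail b c hub hbc ih =>
    rcases ih with ih | ⟨h1, h2⟩
    · obtain ⟨x, hx, hxe⟩ := hbc
      rcases Finset.mem_insert.1 hx with rfl | hx
      · right
        rw [hxe]
        exact ⟨hub, ReflTransGen.refl⟩
      · exact Or.inl (ih.tail ⟨x, hx, hxe⟩)
    · exact Or.inr ⟨h1, h2.tail hbc⟩

theorem AcyclicOn.mono {G : DGraph n k} {A B : Finset (Fin k)} (h : A ⊆ B)
    (hB : G.AcyclicOn B) : G.AcyclicOn A :=
  fun i hi hw => hB i (h hi) (hw.mono h)

/-- A new cycle would have to use `i`, and could be rotated into a walk from the head of `i` to its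
tail. -/
theorem acyclicOn_insert_iff {G : DGraph n k} {A : Finset (Fin k)} {i : Fin k}
    (h : ¬ G.Walks (insert i A) (G i).2 (G i).1) :
    G.AcyclicOn (insert i A) ↔ G.AcyclicOn A := by
  refine ⟨fun hA => hA.mono (Finset.subset_insert i A), fun hA j hj hw => ?_⟩
  rcases Finset.mem_insert.1 hj with rfl | hjA
  · exact h hw
  · rcases hw.of_insert with hw' | ⟨h1, h2⟩
    · exact hA j hjA hw'
    · exact h ((h2.tail (G.edgeRel_of_mem hj)).trans h1)

theorem AcyclicOn.exists_sink {G : DGraph n k} {A : Finset (Fin k)} (hA : G.AcyclicOn A)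
    {U : Finset (Fin n)} (hU : U.Nonempty) (hcl : ∀ i ∈ A, (G i).1 ∈ U → (G i).2 ∈ U) :
    ∃ u ∈ U, ∀ i ∈ A, (G i).1 ≠ u := by
  -- A minimal element is a vertex of `U` from which no other step can be made.
  let r : Fin n → Fin n → Prop := fun u v => TransGen (G.EdgeRel A) v u
  have : IsTrans (Fin n) r := ⟨fun _ _ _ h1 h2 => h2.trans h1⟩
  have : Std.Irrefl r := ⟨fun u hu => by
    obtain ⟨v, ⟨i, hi, hie⟩, hw⟩ := TransGen.head'_iff.1 hu
    exact hA i hi (by rw [hie]; exact hw)⟩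
  have hwf : WellFounded r := Finite.wellFounded_of_trans_of_irrefl r
  obtain ⟨u, hu, hmin⟩ := hwf.has_min (U : Set (Fin n)) hU
  refine ⟨u, hu, fun i hi hiu => ?_⟩
  subst hiu
  exact hmin _ (hcl i hi hu) (TransGen.single (G.edgeRel_of_mem hi))

open Classical in
/-- The alternating number of acyclic subsets of the edge set `F`. -/
noncomputable def acyclicSum (G : DGraph n k) (F : Finset (Fin k)) : ℤ :=
  ∑ A ∈ F.powerset with G.AcyclicOn A, (-1 : ℤ) ^ A.card

theorem acyclicSum_eq_zero {G : DGraph n k} {F : Finset (Fin k)}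
    (h : ¬ G.TotallyCyclicOn F) : G.acyclicSum F = 0 := by
  classical
  simp only [TotallyCyclicOn, not_forall] at h
  obtain ⟨i, hi, hw⟩ := h
  refine sum_powerset_filter_eq_zero hi fun A hA _ => acyclicOn_insert_iff fun h' => hw ?_
  exact h'.mono (Finset.insert_subset hi hA)

theorem exists_edge_into {G : DGraph n k} {F : Finset (Fin k)} {S : Finset (Fin n)} {u v : Fin n}
    (h : G.Walks F u v) (hu : u ∉ S) (hv : v ∈ S) : ∃ i ∈ F, (G i).1 ∉ S ∧ (G i).2 ∈ S := by
  induction h with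
  | refl => exact absurd hv hu
  | @tail b c _ hbc ih =>
    by_cases hb : b ∈ S
    · exact ih hb
    · obtain ⟨i, hi, hie⟩ := hbc
      exact ⟨i, hi, by rwa [hie], by rwa [hie]⟩

theorem sum_nonempty_sinks {U S : Finset (Fin n)} (hS : S ⊆ U) (hne : S.Nonempty) :
    ∑ T ∈ U.powerset.erase ∅, (if T ⊆ S then (-1 : ℤ) ^ (T.card + 1) else 0) = 1 := by
  have h0 : ∑ T ∈ U.powerset, (if T ⊆ S then (-1 : ℤ) ^ (T.card + 1) else 0) = 0 := by
    rw [← Finset.sum_filter]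
    have : U.powerset.filter (fun T => T ⊆ S) = S.powerset := by
      ext T
      simp only [Finset.mem_filter, Finset.mem_powerset]
      exact ⟨fun h => h.2, fun h => ⟨h.trans hS, h⟩⟩
    rw [this]
    simp only [pow_succ, ← Finset.sum_mul]
    rw [Finset.sum_powerset_neg_one_pow_card_of_nonempty hne, zero_mul]
  rw [← Finset.add_sum_erase _ _ (Finset.empty_mem_powerset U)] at h0
  simp at h0 ⊢
  linarith

/-- Every acyclic `A` has a sink in `U`, so its term can be weighted by the alternating sum over
nonempty sets `T` of such sinks, which is 1. After exchanging sums only `T = U` survives. -/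
theorem acyclicSum_eq_of_stronglyConnected {G : DGraph n k} {F : Finset (Fin k)}
    {U : Finset (Fin n)} (hU : U.Nonempty) (hcl : ∀ i ∈ F, (G i).1 ∈ U → (G i).2 ∈ U)
    (hconn : ∀ u ∈ U, ∀ v ∈ U, G.Walks F u v) :
    G.acyclicSum F = (-1) ^ (U.card + 1) * G.acyclicSum (F.filter fun i => (G i).1 ∉ U) := by
  classical
  have h1 : G.acyclicSum F = ∑ T ∈ U.powerset.erase ∅, (-1 : ℤ) ^ (T.card + 1) *
      ∑ A ∈ F.powerset with (G.AcyclicOn A ∧ ∀ i ∈ A, (G i).1 ∉ T), (-1 : ℤ) ^ A.card := by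
    simp only [Finset.mul_sum, Finset.sum_filter, acyclicSum]
    rw [Finset.sum_comm]
    refine Finset.sum_congr rfl fun A hA => ?_
    rw [Finset.mem_powerset] at hA
    by_cases hac : G.AcyclicOn A
    · obtain ⟨u, hu, hsink⟩ := hac.exists_sink hU fun i hi => hcl i (hA hi)
      have h2 := sum_nonempty_sinks (U := U)
        (S := U.filter fun u => ∀ i ∈ A, (G i).1 ≠ u) (Finset.filter_subset _ _)
        ⟨u, Finset.mem_filter.2 ⟨hu, hsink⟩⟩
      rw [if_pos hac]
      refine (one_mul ((-1 : ℤ) ^ A.card)).symm.trans ?_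
      refine (congrArg (· * (-1 : ℤ) ^ A.card) h2.symm).trans ?_
      rw [Finset.sum_mul]
      refine Finset.sum_congr rfl fun T hT => ?_
      have hTU : T ⊆ U := Finset.mem_powerset.1 (Finset.mem_of_mem_erase hT)
      have hiff : (T ⊆ U.filter fun u => ∀ i ∈ A, (G i).1 ≠ u) ↔
          (G.AcyclicOn A ∧ ∀ i ∈ A, (G i).1 ∉ T) := by
        refine ⟨fun h => ⟨hac, fun i hi hiT => (Finset.mem_filter.1 (h hiT)).2 i hi rfl⟩,
          fun h t ht => Finset.mem_filter.2 ⟨hTU ht, fun i hi hit => h.2 i hi (hit ▸ ht)⟩⟩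
      simp only [hiff]
      split_ifs <;> ring
    · simp [hac]
  rw [h1, Finset.sum_eq_single U]
  · congr 1
    refine Finset.sum_congr ?_ fun _ _ => rfl
    ext A
    simp only [Finset.mem_filter, Finset.mem_powerset, Finset.subset_iff]
    exact ⟨fun h => ⟨fun i hi => ⟨h.1 hi, h.2.2 i hi⟩, h.2.1⟩,
      fun h => ⟨fun i hi => (h.1 hi).1, h.2, fun i hi => (h.1 hi).2⟩⟩
  · intro T hT hTU
    rw [Finset.mem_erase, Finset.mem_powerset] at hT
    obtain ⟨v, hv⟩ := Finset.nonempty_iff_ne_empty.2 hT.1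
    obtain ⟨u, hu, huT⟩ := Finset.exists_of_ssubset (hT.2.ssubset_of_ne hTU)
    -- An edge entering `T` from outside can be toggled: no edge leaves `T`, so it lies on no cycle.
    obtain ⟨i, hi, hi1, hi2⟩ := exists_edge_into (hconn u hu v (hT.2 hv)) huT hv
    rw [sum_powerset_filter_eq_zero hi, mul_zero]
    intro A _ _
    rw [Finset.forall_mem_insert]
    by_cases hs : ∀ j ∈ A, (G j).1 ∉ T
    · rw [acyclicOn_insert_iff]
      · simp [hi1]
      · intro hw
        rcases hw.cases_head with h | ⟨c, ⟨j, hj, hje⟩, -⟩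
        · exact hi1 (h ▸ hi2)
        · have hjT : (G j).1 ∈ T := by rw [hje]; exact hi2
          rcases Finset.mem_insert.1 hj with rfl | hj
          · exact hi1 hjT
          · exact hs j hj hjT
    · simp [hs]
  · intro h
    exact absurd (Finset.mem_erase.2 ⟨hU.ne_empty, Finset.mem_powerset_self U⟩) h

/-! ### Connected components of totally cyclic edge sets -/

/-- The simple graph underlying the subgraph of `G` with edge set `F`. -/
def simpleGraphOn (G : DGraph n k) (F : Finset (Fin k)) : SimpleGraph (Fin n) :=
  SimpleGraph.fromRel (G.EdgeRel F)

theorem connectedComponentMk_eq (G : DGraph n k) {F : Finset (Fin k)} {i : Fin k} (hi : i ∈ F) :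
    (G.simpleGraphOn F).connectedComponentMk (G i).1 =
      (G.simpleGraphOn F).connectedComponentMk (G i).2 := by
  by_cases h : (G i).1 = (G i).2
  · rw [h]
  · refine SimpleGraph.ConnectedComponent.sound (SimpleGraph.Adj.reachable ?_)
    exact (SimpleGraph.fromRel_adj _ _ _).2 ⟨h, Or.inl (G.edgeRel_of_mem hi)⟩

theorem TotallyCyclicOn.walks_of_reachable {G : DGraph n k} {F : Finset (Fin k)}
    (h : G.TotallyCyclicOn F) {u v : Fin n} (huv : (G.simpleGraphOn F).Reachable u v) :
    G.Walks F u v := by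
  rw [SimpleGraph.reachable_iff_reflTransGen] at huv
  induction huv with
  | refl => exact ReflTransGen.refl
  | @tail b c _ hbc ih =>
    refine ih.trans ?_
    rcases ((SimpleGraph.fromRel_adj _ _ _).1 hbc).2 with hr | ⟨i, hi, hie⟩
    · exact ReflTransGen.single hr
    -- A backward edge is traversed along the rest of its cycle.
    · simpa [hie] using h i hi

theorem Walks.restrict {G : DGraph n k} {F : Finset (Fin k)} {u v : Fin n} (h : G.Walks F u v)
    (p : (G.simpleGraphOn F).ConnectedComponent → Prop) [DecidablePred p]
    (hu : p ((G.simpleGraphOn F).connectedComponentMk u)) :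
    G.Walks (F.filter fun i => p ((G.simpleGraphOn F).connectedComponentMk (G i).1)) u v := by
  induction h using ReflTransGen.head_induction_on with
  | refl => exact ReflTransGen.refl
  | @head a c hac _ ih =>
    obtain ⟨i, hi, hie⟩ := hac
    have hc := G.connectedComponentMk_eq hi
    have h1 : (G i).1 = a := by rw [hie]
    have h2 : (G i).2 = c := by rw [hie]
    refine (ih ?_).head ⟨i, Finset.mem_filter.2 ⟨hi, by rwa [h1]⟩, hie⟩
    rwa [← h2, ← hc, h1]

open Classical in
theorem TotallyCyclicOn.acyclicSum_filter {G : DGraph n k} {F : Finset (Fin k)}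
    (h : G.TotallyCyclicOn F) (W : Finset (G.simpleGraphOn F).ConnectedComponent) :
    G.acyclicSum (F.filter fun i => (G.simpleGraphOn F).connectedComponentMk (G i).1 ∈ W) =
      (-1) ^ (∑ c ∈ W,
        ((Finset.univ.filter fun v => (G.simpleGraphOn F).connectedComponentMk v = c).card + 1)) := by
  induction W using Finset.induction_on with
  | empty => simp [acyclicSum, AcyclicOn, Finset.filter_singleton]
  | insert c W hc ih =>
    set U : Finset (Fin n) :=
      Finset.univ.filter fun v => (G.simpleGraphOn F).connectedComponentMk v = c with hUdef
    have hmem : ∀ v, v ∈ U ↔ (G.simpleGraphOn F).connectedComponentMk v = c := by simp [hUdef]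
    rw [Finset.sum_insert hc, pow_add, ← ih, acyclicSum_eq_of_stronglyConnected (U := U)]
    · congr 2
      ext i
      simp only [Finset.mem_filter, Finset.mem_insert, hmem]
      refine ⟨by tauto, fun hi => ⟨⟨hi.1, Or.inr hi.2⟩, fun hic => hc (hic ▸ hi.2)⟩⟩
    · obtain ⟨v, hv⟩ := c.exists_rep
      exact ⟨v, (hmem v).2 hv⟩
    · intro i hi
      rw [hmem, hmem, ← G.connectedComponentMk_eq (Finset.mem_filter.1 hi).1]
      exact id
    · intro u hu v hv
      rw [hmem] at hu hv
      refine (h.walks_of_reachable (SimpleGraph.ConnectedComponent.exact (hu.trans hv.symm))).restrict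
        (fun d => d ∈ insert c W) ?_
      rw [hu]
      exact Finset.mem_insert_self c W

theorem TotallyCyclicOn.acyclicSum_eq {G : DGraph n k} {F : Finset (Fin k)}
    (h : G.TotallyCyclicOn F) :
    G.acyclicSum F = (-1) ^ (n + Nat.card (G.simpleGraphOn F).ConnectedComponent) := by
  classical
  have := h.acyclicSum_filter Finset.univ
  simp only [Finset.mem_univ, Finset.filter_true] at this
  rw [this, Finset.sum_add_distrib,
    ← Finset.card_eq_sum_card_fiberwise (s := Finset.univ) (t := Finset.univ)
      (f := (G.simpleGraphOn F).connectedComponentMk) (fun _ _ => Finset.mem_coe.2 (Finset.mem_univ _))]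
  simp [Nat.card_eq_fintype_card]

/-! ### Möbius inversion over edge sets -/

theorem sum_superset_neg_one_pow_card {α : Type*} [Fintype α] [DecidableEq α] (A : Finset α) :
    ∑ T with A ⊆ T, (-1 : ℤ) ^ T.card = if A = Finset.univ then (-1) ^ Fintype.card α else 0 := by
  split_ifs with h
  · subst h
    simp [Finset.univ_subset_iff, Finset.filter_eq', Finset.card_univ]
  · obtain ⟨i, hi⟩ : ∃ i, i ∉ A := by simpa [Finset.eq_univ_iff_forall] using h
    rw [← Finset.powerset_univ]
    refine sum_powerset_filter_eq_zero (Finset.mem_univ i) fun T _ _ => ?_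
    rw [Finset.subset_insert_iff_of_notMem hi]

open Classical in
/-- The alternating sum over totally cyclic edge sets vanishes unless the graph is acyclic. -/
theorem sum_totallyCyclicOn (G : DGraph n k) :
    ∑ T : Finset (Fin k), (if G.TotallyCyclicOn T then
      (-1 : ℤ) ^ (T.card + Nat.card (G.simpleGraphOn T).ConnectedComponent) else 0) =
      if G.IsAcyclic then (-1) ^ n else 0 := by
  have h1 : ∀ T : Finset (Fin k), (if G.TotallyCyclicOn T then
      (-1 : ℤ) ^ (T.card + Nat.card (G.simpleGraphOn T).ConnectedComponent) else 0) =
      ∑ A, if A ⊆ T then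
        ((-1) ^ n * if G.AcyclicOn A then (-1 : ℤ) ^ A.card else 0) * (-1) ^ T.card else 0 := by
    intro T
    rw [← Finset.sum_filter, ← Finset.sum_mul, ← Finset.mul_sum]
    have : (Finset.univ.filter fun A => A ⊆ T) = T.powerset := by ext; simp
    rw [this, ← Finset.sum_filter]
    change _ = (-1) ^ n * G.acyclicSum T * _
    split_ifs with hT
    · have hn : ((-1 : ℤ) ^ n) * (-1) ^ n = 1 := by rw [← mul_pow]; simp
      rw [hT.acyclicSum_eq, pow_add, pow_add, ← mul_assoc, hn]
      ring
    · rw [acyclicSum_eq_zero hT]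
      ring
  simp only [h1]
  rw [Finset.sum_comm]
  simp only [← Finset.sum_filter, ← Finset.mul_sum, sum_superset_neg_one_pow_card]
  rw [Finset.sum_eq_single Finset.univ]
  · have hk : ((-1 : ℤ) ^ k) * (-1) ^ k = 1 := by rw [← mul_pow]; simp
    rw [if_pos rfl, Finset.card_univ, Fintype.card_fin]
    simp only [isAcyclic_iff]
    split_ifs
    · rw [mul_assoc, hk, mul_one]
    · simp
  · intro A _ hA
    simp [hA]
  · simp

/-! ### Coefficients of the Laplace operator -/

/-- The graph `G` with the edges in `S` replaced by loops at their starting points. -/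
def replaceByLoops (G : DGraph n k) (S : Finset (Fin k)) : DGraph n k :=
  fun i => if i ∈ S then ((G i).1, (G i).1) else G i

/-- A loopless-at-`i` graph `H` arises only from itself and from the graph whose edge `i` is the
loop at the same start. -/
theorem edgeOp_apply (i : Fin k) (x : Space n k) (H : DGraph n k) :
    edgeOp i x H =
      if (H i).1 = (H i).2 then 0 else x H - x (replaceEdge (H i).1 (H i).1 i H) := by
  induction x using Finsupp.induction_linear with
  | zero => simp
  | add f g hf hg =>
    rw [map_add, Finsupp.add_apply, hf, hg]
    split_ifs
    · simp
    · simp only [Finsupp.add_apply]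
      ring
  | single G c =>
    simp only [edgeOp, Finsupp.linearCombination_single, Finsupp.smul_apply, smul_eq_mul]
    by_cases hG : (G i).1 = (G i).2
    · have hsum : (∑ m ∈ Finset.univ.erase (G i).1, basisVec (replaceEdge (G i).1 m i G)) H =
          if (H i).1 ≠ (H i).2 ∧ G = replaceEdge (H i).1 (H i).1 i H then (1 : ℂ) else 0 := by
        rw [Finsupp.finsetSum_apply]
        split_ifs with h
        · obtain ⟨h1, h2⟩ := h
          have hGi : (G i).1 = (H i).1 := by rw [h2]; simp [replaceEdge]
          rw [Finset.sum_eq_single (H i).2]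
          · have : replaceEdge (G i).1 (H i).2 i G = H := by
              rw [hGi, h2]
              simp [replaceEdge]
            simp [basisVec, this]
          · intro m _ hm
            rw [basisVec, Finsupp.single_apply, if_neg]
            intro hH
            exact hm (by rw [← hH]; simp [replaceEdge])
          · intro h'
            exact absurd (Finset.mem_erase.2 ⟨by rw [hGi]; exact h1.symm, Finset.mem_univ _⟩) h'
        · refine Finset.sum_eq_zero fun m hm => ?_
          rw [basisVec, Finsupp.single_apply, if_neg]
          intro hH
          apply h
          subst hH
          refine ⟨by simpa [replaceEdge] using (Finset.ne_of_mem_erase hm).symm, ?_⟩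
          have : ((G i).1, (G i).1) = G i := by ext <;> simp [hG]
          simp [replaceEdge, this]
      rw [if_neg (not_not.2 hG), Finsupp.neg_apply, hsum, Finsupp.single_apply,
        Finsupp.single_apply]
      by_cases hH : (H i).1 = (H i).2
      · simp [hH]
      · have hne : G ≠ H := fun h => hH (h ▸ hG)
        simp [hH, hne]
    · rw [if_pos hG, basisVec, Finsupp.single_apply, Finsupp.single_apply, Finsupp.single_apply]
      have hne : G ≠ replaceEdge (H i).1 (H i).1 i H := by
        intro h
        apply hG
        rw [h]
        simp [replaceEdge]
      by_cases hH : (H i).1 = (H i).2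
      · have hne' : G ≠ H := fun h => hG (h ▸ hH)
        simp [hH, hne']
      · simp [hH, hne]

theorem prod_edgeOp_apply_of_loop (L : List (Fin k)) (x : Space n k) (H : DGraph n k)
    {i : Fin k} (hi : i ∈ L) (hH : (H i).1 = (H i).2) :
    ((L.map fun i => (edgeOp i : Module.End ℂ (Space n k))).prod x) H = 0 := by
  induction L generalizing H with
  | nil => simp at hi
  | cons j L ih =>
    rw [List.map_cons, List.prod_cons, Module.End.mul_apply, edgeOp_apply]
    split_ifs with hj
    · rfl
    · have hij : i ≠ j := fun h => hj (h ▸ hH)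
      have hiL : i ∈ L := (List.mem_cons.1 hi).resolve_left hij
      rw [ih H hiL hH, ih _ hiL (by simpa [replaceEdge, hij] using hH), sub_zero]

theorem prod_edgeOp_apply (L : List (Fin k)) (hL : L.Nodup) (x : Space n k) (H : DGraph n k)
    (hH : ∀ i ∈ L, (H i).1 ≠ (H i).2) :
    ((L.map fun i => (edgeOp i : Module.End ℂ (Space n k))).prod x) H =
      ∑ S ∈ L.toFinset.powerset, (-1 : ℂ) ^ S.card * x (H.replaceByLoops S) := by
  induction L generalizing H with
  | nil =>
    have : H.replaceByLoops ∅ = H := by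
      funext i
      simp [replaceByLoops]
    simp [this]
  | cons j L ih =>
    obtain ⟨hjL, hL⟩ := List.nodup_cons.1 hL
    have hjL' : j ∉ L.toFinset := by simpa using hjL
    rw [List.map_cons, List.prod_cons, Module.End.mul_apply, edgeOp_apply,
      if_neg (hH j List.mem_cons_self), List.toFinset_cons, Finset.sum_powerset_insert hjL',
      ih hL H fun i hi => hH i (List.mem_cons_of_mem j hi), ih hL, sub_eq_add_neg,
      ← Finset.sum_neg_distrib]
    · congr 1
      refine Finset.sum_congr rfl fun S hS => ?_
      have hjS : j ∉ S := fun h => hjL' (Finset.mem_powerset.1 hS h)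
      rw [Finset.card_insert_of_notMem hjS, pow_succ]
      have : replaceByLoops (replaceEdge (H j).1 (H j).1 j H) S = H.replaceByLoops (insert j S) := by
        funext i
        by_cases hij : i = j
        · subst hij
          simp [replaceByLoops, replaceEdge, hjS]
        · simp [replaceByLoops, replaceEdge, hij]
      rw [this]
      ring
    · intro i hi
      have hij : i ≠ j := fun h => hjL (h ▸ hi)
      simpa [replaceEdge, hij] using hH i (List.mem_cons_of_mem j hi)

theorem laplace_apply_of_loop (x : Space n k) (H : DGraph n k) {i : Fin k}
    (hi : (H i).1 = (H i).2) : laplace n k x H = 0 := by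
  rw [laplace, List.ofFn_eq_map]
  exact prod_edgeOp_apply_of_loop _ x H (List.mem_finRange i) hi

theorem laplace_apply (x : Space n k) (H : DGraph n k) (hH : ∀ i, (H i).1 ≠ (H i).2) :
    laplace n k x H = ∑ S : Finset (Fin k), (-1 : ℂ) ^ S.card * x (H.replaceByLoops S) := by
  rw [laplace, List.ofFn_eq_map,
    prod_edgeOp_apply _ (List.nodup_finRange k) x H fun i _ => hH i]
  simp

/-! ### Graphs with some edges replaced by loops -/

theorem edgeRel_replaceByLoops (H : DGraph n k) (S : Finset (Fin k)) {u v : Fin n} (huv : u ≠ v) :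
    (H.replaceByLoops S).EdgeRel Finset.univ u v ↔ H.EdgeRel Sᶜ u v := by
  simp only [EdgeRel, replaceByLoops, Finset.mem_univ, true_and, Finset.mem_compl]
  refine exists_congr fun i => ?_
  by_cases hi : i ∈ S
  · simp only [hi, if_true, not_true, false_and, iff_false]
    intro h
    rw [Prod.mk.injEq] at h
    exact huv (h.1.symm.trans h.2)
  · simp [hi]

theorem walks_replaceByLoops (H : DGraph n k) (S : Finset (Fin k)) (u v : Fin n) :
    (H.replaceByLoops S).Walks Finset.univ u v ↔ H.Walks Sᶜ u v := by
  have aux : ∀ {r s : Fin n → Fin n → Prop}, (∀ {a b}, a ≠ b → r a b → s a b) →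
      ReflTransGen r u v → ReflTransGen s u v := by
    intro r s hrs h
    induction h with
    | refl => exact ReflTransGen.refl
    | @tail b c _ hbc ih =>
      by_cases hb : b = c
      · exact hb ▸ ih
      · exact ih.tail (hrs hb hbc)
  exact ⟨aux fun hab => (edgeRel_replaceByLoops H S hab).1,
    aux fun hab => (edgeRel_replaceByLoops H S hab).2⟩

theorem isTotallyCyclic_replaceByLoops (H : DGraph n k) (S : Finset (Fin k)) :
    (H.replaceByLoops S).IsTotallyCyclic ↔ H.TotallyCyclicOn Sᶜ := by
  rw [isTotallyCyclic_iff]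
  simp only [TotallyCyclicOn, walks_replaceByLoops, Finset.mem_univ, true_imp_iff,
    Finset.mem_compl]
  refine forall_congr' fun i => ?_
  by_cases hi : i ∈ S
  · simp [replaceByLoops, hi, ReflTransGen.refl]
  · simp [replaceByLoops, hi]

theorem betti0_replaceByLoops (H : DGraph n k) (S : Finset (Fin k)) :
    (H.replaceByLoops S).betti0 = Nat.card (H.simpleGraphOn Sᶜ).ConnectedComponent := by
  have : (H.replaceByLoops S).toSimpleGraph = H.simpleGraphOn Sᶜ := by
    ext u v
    simp only [toSimpleGraph, simpleGraphOn, SimpleGraph.fromRel_adj]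
    refine and_congr_right fun huv => ?_
    rw [← edgeRel_replaceByLoops H S huv, ← edgeRel_replaceByLoops H S (Ne.symm huv)]
    simp [EdgeRel]
  rw [betti0, this]

/-- Starting points are unchanged, and total cyclicity provides an edge leaving the head of each
kept edge. -/
theorem isIsolated_replaceByLoops_iff {H : DGraph n k} {S : Finset (Fin k)}
    (h : H.TotallyCyclicOn Sᶜ) (v : Fin n) : (H.replaceByLoops S).IsIsolated v ↔ H.IsSink v := by
  have h1 : ∀ i, (H.replaceByLoops S i).1 = (H i).1 := by
    intro i
    simp only [replaceByLoops]
    split_ifs <;> rfl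
  refine ⟨fun hv i => h1 i ▸ (hv i).1, fun hv i => ⟨h1 i ▸ hv i, ?_⟩⟩
  by_cases hi : i ∈ S
  · simpa [replaceByLoops, hi] using hv i
  · simp only [replaceByLoops, hi, if_false]
    rintro rfl
    rcases (h i (Finset.mem_compl.2 hi)).cases_head with h' | ⟨c, ⟨j, -, hj⟩, -⟩
    · exact hv i h'.symm
    · exact hv j (by rw [hj])

theorem not_isAcyclic_of_loop {H : DGraph n k} {i : Fin k} (hi : (H i).1 = (H i).2) :
    ¬ H.IsAcyclic := by
  rw [isAcyclic_iff]
  exact fun h => h i (Finset.mem_univ i) (hi ▸ ReflTransGen.refl)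

theorem sum_smul_basisVec_apply (s : Finset (DGraph n k)) (c : DGraph n k → ℂ) (H : DGraph n k) :
    (∑ G ∈ s, c G • basisVec G) H = if H ∈ s then c H else 0 := by
  classical
  simp [Finsupp.finsetSum_apply, basisVec, Finsupp.single_apply]

theorem mem_SSC_replaceByLoops {H : DGraph n k} {S : Finset (Fin k)} {I : Finset (Fin n)} :
    H.replaceByLoops S ∈ SSC n k I ↔
      H.TotallyCyclicOn Sᶜ ∧ ∀ v, H.IsSink v ↔ v ∈ I := by
  simp only [SSC, Finset.mem_filter, Finset.mem_univ, true_and, isTotallyCyclic_replaceByLoops]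
  exact and_congr_right fun h => forall_congr' fun v => by rw [isIsolated_replaceByLoops_iff h]

end DGraph

/-! ### Comparison of coefficients -/

open DGraph in
theorem corollary3 (n k : ℕ) (I : Finset (Fin n)) :
    DGraph.laplace n k (DGraph.diagMinor n k I) =
      ((-1 : ℂ) ^ n / (k.factorial : ℂ)) • ∑ G ∈ DGraph.AC n k I, DGraph.basisVec G := by
  classical
  ext H
  have hR : (∑ G ∈ AC n k I, basisVec G) H = if H ∈ AC n k I then (1 : ℂ) else 0 := by
    simpa using sum_smul_basisVec_apply (AC n k I) (fun _ => 1) H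
  rw [Finsupp.smul_apply, smul_eq_mul, hR]
  by_cases hloop : ∃ i, (H i).1 = (H i).2
  · obtain ⟨i, hi⟩ := hloop
    rw [laplace_apply_of_loop _ H hi, if_neg, mul_zero]
    intro h
    exact not_isAcyclic_of_loop hi (Finset.mem_filter.1 h).2.1
  · push Not at hloop
    rw [laplace_apply _ H hloop]
    simp only [diagMinor, Finsupp.smul_apply, smul_eq_mul, sum_smul_basisVec_apply,
      mem_SSC_replaceByLoops]
    by_cases hI : ∀ v, H.IsSink v ↔ v ∈ I
    · have key : ∑ S : Finset (Fin k), (if H.TotallyCyclicOn Sᶜ then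
          (-1 : ℂ) ^ (Sᶜ.card + Nat.card (H.simpleGraphOn Sᶜ).ConnectedComponent) else 0) =
          if H.IsAcyclic then (-1) ^ n else 0 := by
        have h := congrArg (Int.cast : ℤ → ℂ) (sum_totallyCyclicOn H)
        push_cast at h
        rw [← h]
        exact Fintype.sum_bijective compl compl_involutive.bijective _ _ fun S => by simp
      have hAC : H ∈ AC n k I ↔ H.IsAcyclic := by simp [AC, hI]
      have hsum : (∑ S : Finset (Fin k), (-1 : ℂ) ^ S.card * ((-1 : ℂ) ^ k / (k.factorial : ℂ) *
          if H.TotallyCyclicOn Sᶜ ∧ ∀ v, H.IsSink v ↔ v ∈ I then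
            (-1 : ℂ) ^ (H.replaceByLoops S).betti0 else 0)) =
          (k.factorial : ℂ)⁻¹ * (if H.IsAcyclic then (-1 : ℂ) ^ n else 0) := by
        rw [← key, Finset.mul_sum]
        refine Finset.sum_congr rfl fun S _ => ?_
        by_cases hS : H.TotallyCyclicOn Sᶜ
        · have hk : k = Sᶜ.card + S.card := by
            rw [Finset.card_compl_add_card, Fintype.card_fin]
          have hsq : ((-1 : ℂ) ^ S.card) * (-1) ^ S.card = 1 := by rw [← mul_pow]; simp
          -- The sign (-1)^k of the minor turns |S| into |Sᶜ|.
          have hpow : ((-1 : ℂ) ^ S.card) * (-1) ^ k = (-1) ^ Sᶜ.card := by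
            rw [congrArg ((-1 : ℂ) ^ ·) hk, pow_add, mul_left_comm, hsq, mul_one]
          rw [if_pos ⟨hS, hI⟩, if_pos hS, betti0_replaceByLoops, pow_add, ← hpow]
          ring
        · simp [hS]
      simp only [hsum, hAC]
      split_ifs
      · ring
      · simp
    · simp [AC, hI]
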